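/- A cylindric partition with profile $c=(3,1)$ (rank $2$, level $4$) is a pair $\Lambda=(\lambda^{(1)},\lambda^{(2)})$ of ordinary partitions $\lambda^{(i)}=(\lambda^{(i)}_1\ge\lambda^{(i)}_2\ge\cdots)$, each extended by infinitely many zeros (the empty partition is allowed), such that for all $j\ge 1$ $$\lambda^{(1)}_j\ge\lambda^{(2)}_{j+1},\qquad \lambda^{(2)}_j\ge\lambda^{(1)}_{j+3}.$$ Its size $|\Lambda|$ is the sum of all parts of $\lambda^{(1)}$ and $\lambda^{(2)}$. Write $P_{(3,1)}$ for the set of all such $\Lambda$, $(a;q)_n=\prod_{k=1}^n(1-aq^{k-1})$ and $(a;q)_\infty=\lim_{n\to\infty}(a;q)_n$. Then for every complex $q$ with $|q|<1$ the series and the infinite products below converge (the sum over $P_{(3,1)}$ absolutely), all denominators are nonzero, and $$\sum_{\Lambda\in P_{(3,1)}}q^{|\Lambda|}=\left(\sum_{n\ge 0}\frac{q^{n^2}}{(q^2;q^2)_n}\right)\cdot\frac{(-q^2;q^2)_\infty}{(q;q)_\infty}.$$ -/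

import Mathlib

open Filter Topology

/-- A cylindric partition of rank `r` with profile `c = (c₀, …, c_{r-1})` (indices taken cyclically,
so `i + 1` wraps around to `0` at `i = r - 1`). The `i`-th ordinary partition is stored as the finitely
supported non-increasing sequence `part i` of its parts, extended by zeros. -/
@[ext]
structure CylindricPartition {r : ℕ} [NeZero r] (c : Fin r → ℕ) where
  /-- The `j`-th part of the `i`-th ordinary partition is `part i j`. -/
  part : Fin r → ℕ →₀ ℕ
  antitone_part : ∀ i, Antitone (part i)
  part_shift_le : ∀ i j, part (i + 1) (j + c (i + 1)) ≤ part i j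

/-- The size: the sum of all the parts of all the ordinary partitions. -/
def CylindricPartition.size {r : ℕ} [NeZero r] {c : Fin r → ℕ} (Λ : CylindricPartition c) : ℕ :=
  ∑ i, (Λ.part i).sum fun _ m => m

/-- The finite `q`-Pochhammer symbol `(a; q)_n`. -/
def qPoch (a q : ℂ) (n : ℕ) : ℂ := ∏ k ∈ Finset.range n, (1 - a * q ^ k)

/-- The infinite `q`-Pochhammer symbol `(a; q)_∞`, the limit of `(a; q)_n` as `n → ∞`. -/
noncomputable def qPochInf (a q : ℂ) : ℂ := limUnder atTop (qPoch a q)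

/-!
Bound the lengths: let `S(a, b)` be the generating function of the cylindric partitions of profile
`(3, 1)` whose two partitions have at most `a` and `b` nonzero parts. In the strip
`b - 1 ≤ a ≤ b + 3` one may add `1` to the first `a` parts of the one and the first `b` parts of the
other partition without leaving the set, and every element arises in a unique way by adding such
full layers to one in which a partition is shorter than allowed (`bijective_addLayers`). This
proves convergence and gives
`(1 - q^(a+b)) S(a, b) = S(a-1, b) + S(a, b-1) - S(a-1, b-1)`,
with simpler forms on the edges of the strip (`genFun_succ_succ`, `genFun_self_succ`,
`genFun_add_three`, `genFun_succ_zero`).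

The strip consists of five diagonals. Eliminating four of them leaves a second-order recurrence for
`S(m+1, m)` (`genFun_recurrence`), which is solved (`genFun_succ_self`) by
`S(m+1, m) = (q²;q²)_m / (q;q)_{2m+1} * ∑_{n+k=m} q^(n²) (-q²;q²)_k / ((q²;q²)_n (q²;q²)_k)`:
the two factors of the convolution satisfy first-order `q`-recurrences, and these combine to the
same second-order recurrence (`qConv_recurrence`).

As `m → ∞`, Tannery's theorem turns the convolution into the product of the sum of its first factor
and the limit of its second (`tendsto_qConv`), which gives the right-hand side (`tendsto_genFun`).
Taken at `‖q‖`, this limit bounds the sums of absolute values, so the sum over all cylindric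
partitions converges absolutely and is the limit of `S(m+1, m)` (`hasSum_pow_size`).
-/

/-! ### Infinite `q`-Pochhammer symbols -/

lemma qPoch_zero (a q : ℂ) : qPoch a q 0 = 1 := by simp [qPoch]

lemma qPoch_succ (a q : ℂ) (n : ℕ) : qPoch a q (n + 1) = qPoch a q n * (1 - a * q ^ n) :=
  Finset.prod_range_succ _ _

lemma norm_pow_lt_one {q : ℂ} (hq : ‖q‖ < 1) {n : ℕ} (hn : n ≠ 0) : ‖q ^ n‖ < 1 := by
  rw [norm_pow]; exact pow_lt_one₀ (norm_nonneg q) hq hn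

lemma one_sub_pow_ne_zero {q : ℂ} (hq : ‖q‖ < 1) {n : ℕ} (hn : n ≠ 0) : 1 - q ^ n ≠ 0 := by
  intro h
  have := norm_pow_lt_one hq hn
  rw [← sub_eq_zero.mp h, norm_one] at this
  exact lt_irrefl _ this

lemma qPoch_self_ne_zero {q : ℂ} (hq : ‖q‖ < 1) (n : ℕ) : qPoch q q n ≠ 0 := by
  refine Finset.prod_ne_zero_iff.mpr fun k _ => ?_
  rw [← pow_succ']
  exact one_sub_pow_ne_zero hq k.succ_ne_zero

lemma summable_norm_neg_mul_pow (a : ℂ) {q : ℂ} (hq : ‖q‖ < 1) :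
    Summable fun k : ℕ => ‖-(a * q ^ k)‖ := by
  simp_rw [norm_neg, norm_mul, norm_pow]
  exact (summable_geometric_of_lt_one (norm_nonneg q) hq).mul_left _

lemma tendsto_qPoch_tprod (a : ℂ) {q : ℂ} (hq : ‖q‖ < 1) :
    Tendsto (qPoch a q) atTop (𝓝 (∏' k : ℕ, (1 + -(a * q ^ k)))) := by
  have h := (multipliable_one_add_of_summable
    (summable_norm_neg_mul_pow a hq)).hasProd.tendsto_prod_nat
  refine h.congr fun n => ?_
  simp only [qPoch, sub_eq_add_neg]

lemma tendsto_qPoch (a : ℂ) {q : ℂ} (hq : ‖q‖ < 1) :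
    Tendsto (qPoch a q) atTop (𝓝 (qPochInf a q)) :=
  tendsto_nhds_limUnder ⟨_, tendsto_qPoch_tprod a hq⟩

lemma qPochInf_self_ne_zero {q : ℂ} (hq : ‖q‖ < 1) : qPochInf q q ≠ 0 := by
  rw [tendsto_nhds_unique (tendsto_qPoch q hq) (tendsto_qPoch_tprod q hq)]
  refine tprod_one_add_ne_zero_of_summable (fun k => ?_) (summable_norm_neg_mul_pow q hq)
  rw [← sub_eq_add_neg, ← pow_succ']
  exact one_sub_pow_ne_zero hq k.succ_ne_zero

/-- The denominators stay away from zero because their limit is nonzero, and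
`‖q‖ ^ (n ^ 2) ≤ ‖q‖ ^ n`. -/
lemma summable_pow_sq_div_qPoch {q : ℂ} (hq : ‖q‖ < 1) :
    Summable fun n : ℕ => q ^ (n ^ 2) / qPoch (q ^ 2) (q ^ 2) n := by
  have hQ := norm_pow_lt_one hq two_ne_zero
  have hlim := (tendsto_qPoch (q ^ 2) hQ).inv₀ (qPochInf_self_ne_zero hQ)
  obtain ⟨C, hC⟩ := (isBounded_iff_forall_norm_le.mp (Metric.isBounded_range_of_tendsto _ hlim))
  refine Summable.of_norm_bounded
    ((summable_geometric_of_lt_one (norm_nonneg q) hq).mul_right C) fun n => ?_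
  rw [div_eq_mul_inv, norm_mul, norm_pow]
  exact mul_le_mul
    (pow_le_pow_of_le_one (norm_nonneg q) hq.le (Nat.le_self_pow two_ne_zero n))
    (hC _ ⟨n, rfl⟩) (norm_nonneg _) (pow_nonneg (norm_nonneg q) n)

/-! ### Limits of convolutions -/

/-- Tannery's theorem for Cauchy products: the convolution of a summable sequence with a convergent
one tends to the product of the sum and the limit. -/
lemma tendsto_sum_antidiagonal_mul {f g : ℕ → ℂ} {b : ℂ} (hf : Summable f)
    (hg : Tendsto g atTop (𝓝 b)) :
    Tendsto (fun M => ∑ p ∈ Finset.HasAntidiagonal.antidiagonal M, f p.1 * g p.2) atTop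
      (𝓝 ((∑' n, f n) * b)) := by
  obtain ⟨C, hC⟩ := (isBounded_iff_forall_norm_le.mp (Metric.isBounded_range_of_tendsto _ hg))
  have hC0 : 0 ≤ C := (norm_nonneg _).trans (hC _ ⟨0, rfl⟩)
  have key : ∀ M, ∑ p ∈ Finset.HasAntidiagonal.antidiagonal M, f p.1 * g p.2
      = ∑' n, if n < M + 1 then f n * g (M - n) else 0 := fun M => by
    rw [Finset.Nat.sum_antidiagonal_eq_sum_range_succ (fun i j => f i * g j),
      tsum_eq_sum (s := Finset.range (M + 1)) fun n hn => if_neg (by simpa using hn)]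
    exact Finset.sum_congr rfl fun n hn => (if_pos (Finset.mem_range.mp hn)).symm
  simp_rw [key, ← tsum_mul_right]
  refine tendsto_tsum_of_dominated_convergence (hf.norm.mul_right C) (fun n => ?_)
    (Eventually.of_forall fun M n => ?_)
  · refine Tendsto.congr' ?_ ((hg.comp (tendsto_sub_atTop_nat n)).const_mul (f n))
    filter_upwards [eventually_ge_atTop n] with M hM
    simp [Nat.lt_succ_of_le hM]
  · split_ifs
    · rw [norm_mul]
      gcongr
      exact hC _ ⟨_, rfl⟩
    · simpa using mul_nonneg (norm_nonneg (f n)) hC0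

/-! ### A `q`-convolution and its recurrence -/

/-- The convolution `∑_{n+k=M} q^(n²) (-q²;q²)_k / ((q²;q²)_n (q²;q²)_k)`. -/
noncomputable def qConv (q : ℂ) (M : ℕ) : ℂ :=
  ∑ p ∈ Finset.HasAntidiagonal.antidiagonal M, q ^ (p.1 ^ 2) / qPoch (q ^ 2) (q ^ 2) p.1 *
    (qPoch (-q ^ 2) (q ^ 2) p.2 / qPoch (q ^ 2) (q ^ 2) p.2)

lemma qConv_zero (q : ℂ) : qConv q 0 = 1 := by simp [qConv, qPoch_zero]

lemma tendsto_qConv {q : ℂ} (hq : ‖q‖ < 1) :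
    Tendsto (qConv q) atTop (𝓝 ((∑' n : ℕ, q ^ (n ^ 2) / qPoch (q ^ 2) (q ^ 2) n) *
      (qPochInf (-q ^ 2) (q ^ 2) / qPochInf (q ^ 2) (q ^ 2)))) := by
  have hQ := norm_pow_lt_one hq two_ne_zero
  have hβ : Tendsto (fun k => qPoch (-q ^ 2) (q ^ 2) k / qPoch (q ^ 2) (q ^ 2) k) atTop
      (𝓝 (qPochInf (-q ^ 2) (q ^ 2) / qPochInf (q ^ 2) (q ^ 2))) :=
    (tendsto_qPoch _ hQ).div (tendsto_qPoch _ hQ) (qPochInf_self_ne_zero hQ)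
  have h := tendsto_sum_antidiagonal_mul (summable_pow_sq_div_qPoch hq) hβ
  exact h

section Convolution

open Finset hiding antidiagonal
open Finset.HasAntidiagonal

lemma sum_antidiagonal_one_sub_pow_mul {q : ℂ} {a : ℕ → ℂ} (b : ℕ → ℂ)
    (ha : ∀ n, (1 - (q ^ 2) ^ (n + 1)) * a (n + 1) = q ^ (2 * n + 1) * a n) (M : ℕ) :
    ∑ p ∈ antidiagonal (M + 1), ((1 - (q ^ 2) ^ p.1) * a p.1) * ((q ^ 2) ^ p.2 * b p.2)
      = q ^ (2 * M + 1) * ∑ p ∈ antidiagonal M, a p.1 * b p.2 := by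
  rw [Nat.sum_antidiagonal_succ]
  simp only [pow_zero, sub_self, zero_mul, zero_add, ha, mul_sum]
  refine sum_congr rfl fun p hp => ?_
  rw [← mem_antidiagonal.mp hp]
  ring

lemma sum_antidiagonal_mul_one_sub_pow {q : ℂ} (a : ℕ → ℂ) {b : ℕ → ℂ}
    (hb : ∀ k, (1 - (q ^ 2) ^ (k + 1)) * b (k + 1) = (1 + (q ^ 2) ^ (k + 1)) * b k) (M : ℕ) :
    ∑ p ∈ antidiagonal (M + 1), a p.1 * ((1 - (q ^ 2) ^ p.2) * b p.2)
      = ∑ p ∈ antidiagonal M, a p.1 * b p.2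
        + q ^ 2 * ∑ p ∈ antidiagonal M, (q ^ 2) ^ p.2 * (a p.1 * b p.2) := by
  rw [Nat.sum_antidiagonal_succ', mul_sum, ← sum_add_distrib]
  simp only [pow_zero, sub_self, zero_mul, mul_zero, zero_add, hb]
  exact sum_congr rfl fun p _ => by ring

/-- With `Q = q²`, the convolution of solutions of the first-order recurrences
`(1 - Q^n) a_n = q^(2n-1) a_{n-1}` and `(1 - Q^k) b_k = (1 + Q^k) b_{k-1}` satisfies a second-order
recurrence. -/
lemma sum_antidiagonal_recurrence {q : ℂ} {a b : ℕ → ℂ}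
    (ha : ∀ n, (1 - (q ^ 2) ^ (n + 1)) * a (n + 1) = q ^ (2 * n + 1) * a n)
    (hb : ∀ k, (1 - (q ^ 2) ^ (k + 1)) * b (k + 1) = (1 + (q ^ 2) ^ (k + 1)) * b k) (M : ℕ) :
    (1 - q ^ (2 * M + 4)) * ∑ p ∈ antidiagonal (M + 2), a p.1 * b p.2
      = (1 + q ^ (2 * M + 4) + q ^ (2 * M + 3)) * ∑ p ∈ antidiagonal (M + 1), a p.1 * b p.2
        + q ^ (2 * M + 3) * ∑ p ∈ antidiagonal M, a p.1 * b p.2 := by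
  -- multiply the summand by `1 - Q^(n+k) = (1 - Q^k) + Q^k (1 - Q^n)`
  have h1 : (1 - q ^ (2 * M + 4)) * ∑ p ∈ antidiagonal (M + 2), a p.1 * b p.2
      = ∑ p ∈ antidiagonal (M + 2), a p.1 * ((1 - (q ^ 2) ^ p.2) * b p.2)
        + ∑ p ∈ antidiagonal (M + 2), ((1 - (q ^ 2) ^ p.1) * a p.1) * ((q ^ 2) ^ p.2 * b p.2) := by
    rw [mul_sum, ← sum_add_distrib]
    refine sum_congr rfl fun p hp => ?_
    rw [show 2 * M + 4 = 2 * (M + 2) by ring, ← mem_antidiagonal.mp hp]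
    ring
  -- and here `Q^k = Q^(n+k) + Q^k (1 - Q^n)`
  have h2 : ∑ p ∈ antidiagonal (M + 1), (q ^ 2) ^ p.2 * (a p.1 * b p.2)
      = q ^ (2 * M + 2) * ∑ p ∈ antidiagonal (M + 1), a p.1 * b p.2
        + ∑ p ∈ antidiagonal (M + 1),
            ((1 - (q ^ 2) ^ p.1) * a p.1) * ((q ^ 2) ^ p.2 * b p.2) := by
    rw [mul_sum, ← sum_add_distrib]
    refine sum_congr rfl fun p hp => ?_
    rw [show 2 * M + 2 = 2 * (M + 1) by ring, ← mem_antidiagonal.mp hp]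
    ring
  rw [h1, sum_antidiagonal_mul_one_sub_pow a hb, h2, sum_antidiagonal_one_sub_pow_mul b ha,
    sum_antidiagonal_one_sub_pow_mul b ha]
  ring

end Convolution

lemma qConv_recurrence {q : ℂ} (hq : ‖q‖ < 1) (M : ℕ) :
    (1 - q ^ (2 * M + 4)) * qConv q (M + 2)
      = (1 + q ^ (2 * M + 4) + q ^ (2 * M + 3)) * qConv q (M + 1)
        + q ^ (2 * M + 3) * qConv q M := by
  have hQ := norm_pow_lt_one hq two_ne_zero
  have hne := qPoch_self_ne_zero hQ
  have h1 : ∀ n : ℕ, 1 - q ^ 2 * (q ^ 2) ^ n ≠ 0 := fun n => by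
    rw [← pow_succ']; exact one_sub_pow_ne_zero hQ n.succ_ne_zero
  refine sum_antidiagonal_recurrence (a := fun n => q ^ (n ^ 2) / qPoch (q ^ 2) (q ^ 2) n)
    (b := fun k => qPoch (-q ^ 2) (q ^ 2) k / qPoch (q ^ 2) (q ^ 2) k) (fun n => ?_)
    (fun n => ?_) M
  · have := hne n
    have := h1 n
    simp only [qPoch_succ]
    field_simp
    ring
  · have := hne n
    have := h1 n
    simp only [qPoch_succ]
    field_simp
    ring

lemma qConv_one {q : ℂ} (hq : ‖q‖ < 1) : (1 - q ^ 2) * qConv q 1 = 1 + q + q ^ 2 := by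
  have h := one_sub_pow_ne_zero hq two_ne_zero
  simp [qConv, Finset.Nat.antidiagonal_succ, qPoch]
  field_simp
  ring

namespace CylindricPartition

/-! ### Removing full layers -/

section Layers

variable {r : ℕ} [NeZero r] {c : Fin r → ℕ}

/-- The cylindric partitions whose `i`-th partition has at most `l i` nonzero parts. -/
def boundedBy (l : Fin r → ℕ) : Set (CylindricPartition c) :=
  {Λ | ∀ i j, l i ≤ j → Λ.part i j = 0}

/-- The members of `boundedBy l` in which at least one of the partitions has fewer nonzero parts
than `l` allows. -/
def reduced (l : Fin r → ℕ) : Set (CylindricPartition c) :=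
  {Λ ∈ boundedBy l | ∃ i, 0 < l i ∧ Λ.part i (l i - 1) = 0}

/-- Add `m` to the first `l i` parts of the `i`-th partition, for every `i`. -/
noncomputable def addLayers (l : Fin r → ℕ) (hl : ∀ i, l (i + 1) ≤ l i + c (i + 1)) (m : ℕ)
    (Λ : CylindricPartition c) : CylindricPartition c where
  part i := Λ.part i + Finsupp.onFinset (Finset.range (l i)) (fun j => if j < l i then m else 0)
    (by simp +contextual)
  antitone_part i := by
    intro j k hjk
    have := Λ.antitone_part i hjk
    simp only [Finsupp.coe_add, Pi.add_apply, Finsupp.onFinset_apply]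
    split_ifs <;> omega
  part_shift_le i j := by
    have := Λ.part_shift_le i j
    have := hl i
    simp only [Finsupp.coe_add, Pi.add_apply, Finsupp.onFinset_apply]
    split_ifs <;> omega

/-- Subtract `m` from every part, replacing negative results by zero. -/
noncomputable def removeLayers (m : ℕ) (Λ : CylindricPartition c) : CylindricPartition c where
  part i := (Λ.part i).mapRange (· - m) (Nat.zero_sub m)
  antitone_part i j k hjk := by
    simpa using Nat.sub_le_sub_right (Λ.antitone_part i hjk) m
  part_shift_le i j := by
    simpa using Nat.sub_le_sub_right (Λ.part_shift_le i j) m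

variable {l : Fin r → ℕ} {hl : ∀ i, l (i + 1) ≤ l i + c (i + 1)}

lemma addLayers_part (m : ℕ) (Λ : CylindricPartition c) (i : Fin r) (j : ℕ) :
    (addLayers l hl m Λ).part i j = Λ.part i j + if j < l i then m else 0 := rfl

lemma removeLayers_part (m : ℕ) (Λ : CylindricPartition c) (i : Fin r) (j : ℕ) :
    (removeLayers m Λ).part i j = Λ.part i j - m := rfl

lemma size_addLayers (m : ℕ) (Λ : CylindricPartition c) :
    (addLayers l hl m Λ).size = (∑ i, l i) * m + Λ.size := by
  have h : ∀ i, ((addLayers l hl m Λ).part i).sum (fun _ m => m)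
      = l i * m + (Λ.part i).sum fun _ m => m := fun i => by
    rw [addLayers, Finsupp.sum_add_index' (fun _ => rfl) (fun _ _ _ => rfl), add_comm,
      Finsupp.onFinset_sum _ (fun _ => rfl)]
    congr 1
    rw [Finset.sum_congr rfl fun j hj => if_pos (Finset.mem_range.mp hj)]
    simp
  simp only [size, h, Finset.sum_add_distrib, Finset.sum_mul]

lemma addLayers_mem_boundedBy (m : ℕ) {Λ : CylindricPartition c} (h : Λ ∈ boundedBy l) :
    addLayers l hl m Λ ∈ boundedBy l := fun i j hij => by
  simp [addLayers_part, h i j hij, hij]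

/-- The number `m` of full layers can be read off a decomposition: it is at most every part
within the bounds `l`, with equality at the last such part of one of the partitions. -/
lemma le_of_addLayers_eq {m n : ℕ} {Λ Λ' : CylindricPartition c} (h : Λ ∈ reduced l)
    (e : addLayers l hl m Λ = addLayers l hl n Λ') : n ≤ m := by
  obtain ⟨-, i, hi, h0⟩ := h
  have := congrArg (fun Λ => Λ.part i (l i - 1)) e
  simp only [addLayers_part, h0, Nat.sub_lt hi one_pos, if_true] at this
  omega

/-- Every cylindric partition bounded by `l ≠ 0` arises from a unique reduced one by adding a
unique number of full layers. -/
lemma bijective_addLayers (hl : ∀ i, l (i + 1) ≤ l i + c (i + 1)) (hpos : ∃ i, 0 < l i) :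
    Function.Bijective fun p : ℕ × reduced (c := c) l =>
      (⟨addLayers l hl p.1 p.2, addLayers_mem_boundedBy _ p.2.2.1⟩ : boundedBy (c := c) l) := by
  constructor
  · rintro ⟨m, Λ, hΛ⟩ ⟨n, Λ', hΛ'⟩ h
    have e : addLayers l hl m Λ = addLayers l hl n Λ' := congrArg Subtype.val h
    obtain rfl := le_antisymm (le_of_addLayers_eq hΛ' e.symm) (le_of_addLayers_eq hΛ e)
    have : Λ = Λ' := by
      ext i j
      have := congrArg (fun Λ => Λ.part i j) e
      simpa only [addLayers_part, add_left_inj] using this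
    subst this
    rfl
  · rintro ⟨Λ, hΛ⟩
    obtain ⟨i₀, h0⟩ := hpos
    -- the number of full layers is the least among the last parts within the bounds
    obtain ⟨i, hi, hmin⟩ := Finset.exists_min_image (Finset.univ.filter fun i => 0 < l i)
      (fun i => Λ.part i (l i - 1)) ⟨i₀, by simpa using h0⟩
    have hi' : 0 < l i := by simpa using hi
    refine ⟨⟨Λ.part i (l i - 1), removeLayers (Λ.part i (l i - 1)) Λ, fun k j hkj => ?_, i, hi',
      ?_⟩, Subtype.ext (CylindricPartition.ext (funext fun k => Finsupp.ext fun j => ?_))⟩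
    · simp [removeLayers_part, hΛ k j hkj]
    · simp [removeLayers_part]
    · change (addLayers l hl _ _).part k j = Λ.part k j
      rw [addLayers_part, removeLayers_part]
      split_ifs with hj
      · have h1 := hmin k (by simpa using Nat.zero_lt_of_lt hj)
        have h2 := Λ.antitone_part k (show j ≤ l k - 1 by omega)
        omega
      · simp [hΛ k j (not_lt.mp hj)]

/-- Splitting off the full layers divides the generating function by `1 - q ^ ∑ i, l i`. -/
lemma hasSum_boundedBy (hl : ∀ i, l (i + 1) ≤ l i + c (i + 1)) (hpos : ∃ i, 0 < l i) {q s : ℂ}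
    (hq : ‖q‖ < 1) (h : HasSum (fun Λ : reduced (c := c) l => q ^ Λ.1.size) s) :
    HasSum (fun Λ : boundedBy (c := c) l => q ^ Λ.1.size) ((1 - q ^ ∑ i, l i)⁻¹ * s) := by
  have hN : ∑ i, l i ≠ 0 := by
    obtain ⟨i, hi⟩ := hpos
    exact fun h => hi.ne' (Finset.sum_eq_zero_iff.mp h i (Finset.mem_univ i))
  have hg := hasSum_geometric_of_norm_lt_one (norm_pow_lt_one hq hN)
  have hsum := summable_mul_of_summable_norm hg.summable.norm h.summable.norm
  have hmul := hg.mul h hsum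
  rw [← (Equiv.ofBijective _ (bijective_addLayers hl hpos)).hasSum_iff]
  have e : ((fun Λ : boundedBy (c := c) l => q ^ Λ.1.size) ∘
      Equiv.ofBijective _ (bijective_addLayers hl hpos))
      = fun p : ℕ × reduced (c := c) l => (q ^ ∑ i, l i) ^ p.1 * q ^ p.2.1.size := by
    funext p
    simp only [Function.comp_apply, Equiv.ofBijective_apply, size_addLayers, pow_add, pow_mul]
  rw [e]
  exact hmul

end Layers

/-! ### Profile `(3, 1)`: generating functions with bounded lengths -/

/-- The cylindric partitions of profile `(3, 1)` whose two partitions have at most `a` and `b`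
nonzero parts, respectively. -/
abbrev lengthsLE (a b : ℕ) : Set (CylindricPartition ![3, 1]) := boundedBy ![a, b]

lemma mem_lengthsLE {a b : ℕ} {Λ : CylindricPartition ![3, 1]} :
    Λ ∈ lengthsLE a b ↔ (∀ j, a ≤ j → Λ.part 0 j = 0) ∧ ∀ j, b ≤ j → Λ.part 1 j = 0 := by
  simp [boundedBy, Fin.forall_fin_two]

lemma part_eq_zero_of_le {Λ : CylindricPartition ![3, 1]} {i : Fin 2} {j k : ℕ} (h : j ≤ k)
    (hj : Λ.part i j = 0) : Λ.part i k = 0 :=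
  Nat.eq_zero_of_le_zero ((Λ.antitone_part i h).trans hj.le)

lemma mem_lengthsLE' {a b : ℕ} {Λ : CylindricPartition ![3, 1]} :
    Λ ∈ lengthsLE a b ↔ Λ.part 0 a = 0 ∧ Λ.part 1 b = 0 :=
  mem_lengthsLE.trans ⟨fun h => ⟨h.1 a le_rfl, h.2 b le_rfl⟩,
    fun h => ⟨fun _ hj => part_eq_zero_of_le hj h.1, fun _ hj => part_eq_zero_of_le hj h.2⟩⟩

lemma part_one_succ_eq_zero {Λ : CylindricPartition ![3, 1]} {j : ℕ} (h : Λ.part 0 j = 0) :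
    Λ.part 1 (j + 1) = 0 :=
  Nat.eq_zero_of_le_zero ((Λ.part_shift_le 0 j).trans h.le)

lemma part_zero_add_three_eq_zero {Λ : CylindricPartition ![3, 1]} {j : ℕ}
    (h : Λ.part 1 j = 0) : Λ.part 0 (j + 3) = 0 :=
  Nat.eq_zero_of_le_zero ((Λ.part_shift_le 1 j).trans h.le)

lemma mem_reduced {a b : ℕ} {Λ : CylindricPartition ![3, 1]} :
    Λ ∈ reduced ![a, b] ↔ (Λ.part 0 a = 0 ∧ Λ.part 1 b = 0) ∧
      (0 < a ∧ Λ.part 0 (a - 1) = 0 ∨ 0 < b ∧ Λ.part 1 (b - 1) = 0) := by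
  rw [← mem_lengthsLE']
  change _ ∧ (∃ i, _) ↔ _
  rw [Fin.exists_fin_two]
  rfl

lemma reduced_succ_succ (a b : ℕ) :
    reduced ![a + 1, b + 1] = lengthsLE a (b + 1) ∪ lengthsLE (a + 1) b := by
  ext Λ
  have := part_eq_zero_of_le (Λ := Λ) (i := 0) a.le_succ
  have := part_eq_zero_of_le (Λ := Λ) (i := 1) b.le_succ
  simp only [mem_reduced, Set.mem_union, mem_lengthsLE', Nat.succ_eq_add_one] at *
  simp
  tauto

lemma lengthsLE_inter (a b : ℕ) : lengthsLE a (b + 1) ∩ lengthsLE (a + 1) b = lengthsLE a b := by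
  ext Λ
  have := part_eq_zero_of_le (Λ := Λ) (i := 0) a.le_succ
  have := part_eq_zero_of_le (Λ := Λ) (i := 1) b.le_succ
  simp only [Set.mem_inter_iff, mem_lengthsLE', Nat.succ_eq_add_one] at *
  tauto

lemma reduced_succ_zero (a : ℕ) : reduced ![a + 1, 0] = lengthsLE a 0 := by
  ext Λ
  have := part_eq_zero_of_le (Λ := Λ) (i := 0) a.le_succ
  simp only [mem_reduced, mem_lengthsLE', Nat.succ_eq_add_one] at *
  simp
  tauto

/-- On the edge `b = a + 1` of the strip, the first partition can only lose a part together with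
the second one. -/
lemma reduced_self_succ (a : ℕ) : reduced ![a, a + 1] = lengthsLE a a := by
  ext Λ
  have := part_eq_zero_of_le (Λ := Λ) (i := 1) a.le_succ
  have h : 0 < a → Λ.part 0 (a - 1) = 0 → Λ.part 1 a = 0 := fun ha h => by
    have := part_one_succ_eq_zero h
    rwa [Nat.sub_add_cancel ha] at this
  simp only [mem_reduced, mem_lengthsLE', Nat.succ_eq_add_one] at *
  simp
  tauto

/-- On the edge `a = b + 3` of the strip, the second partition can only lose a part together with
the first one. -/
lemma reduced_add_three (b : ℕ) : reduced ![b + 3, b] = lengthsLE (b + 2) b := by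
  ext Λ
  have := part_eq_zero_of_le (Λ := Λ) (i := 0) (b + 2).le_succ
  have h : 0 < b → Λ.part 1 (b - 1) = 0 → Λ.part 0 (b + 2) = 0 := fun hb h => by
    have := part_zero_add_three_eq_zero h
    rwa [show b - 1 + 3 = b + 2 by omega] at this
  simp only [mem_reduced, mem_lengthsLE', Nat.succ_eq_add_one] at *
  simp
  tauto

/-- The generating function of `lengthsLE a b`. -/
noncomputable def genFun (q : ℂ) (a b : ℕ) : ℂ := ∑' Λ : lengthsLE a b, q ^ Λ.1.size

/-- The full layer with lengths `(a, b)` is itself cylindric when `b - 1 ≤ a ≤ b + 3`. -/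
lemma strip {a b : ℕ} (h₁ : b ≤ a + 1) (h₂ : a ≤ b + 3) (i : Fin 2) :
    ![a, b] (i + 1) ≤ ![a, b] i + ![3, 1] (i + 1) := by
  fin_cases i <;> simpa

/-- `hasSum_boundedBy` for the profile `(3, 1)`. -/
lemma hasSum_lengthsLE {a b : ℕ} (h₁ : b ≤ a + 1) (h₂ : a ≤ b + 3) (hpos : 0 < a + b) {q s : ℂ}
    (hq : ‖q‖ < 1)
    (h : HasSum (fun Λ : reduced (c := ![3, 1]) ![a, b] => q ^ Λ.1.size) s) :
    HasSum (fun Λ : lengthsLE a b => q ^ Λ.1.size) ((1 - q ^ (a + b))⁻¹ * s) := by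
  have := hasSum_boundedBy (strip h₁ h₂) (Fin.exists_fin_two.mpr (by simpa using hpos)) hq h
  simpa using this

lemma hasSum_union_of_inter {α : Type*} {f : α → ℂ} {s t : Set α} {x y z : ℂ}
    (hs : HasSum (fun i : s => f i) x) (ht : HasSum (fun i : t => f i) y)
    (hst : HasSum (fun i : (s ∩ t : Set α) => f i) z) :
    HasSum (fun i : (s ∪ t : Set α) => f i) (x + y - z) := by
  have hs' := hasSum_subtype_iff_indicator.mp hs
  have ht' := hasSum_subtype_iff_indicator.mp ht
  have hst' := hasSum_subtype_iff_indicator.mp hst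
  refine hasSum_subtype_iff_indicator.mpr ?_
  rw [show (s ∪ t).indicator f = fun i => s.indicator f i + t.indicator f i
    - (s ∩ t).indicator f i from funext fun i => by
      have := congrFun (Set.indicator_union_add_inter f s t) i
      simp only [Pi.add_apply] at this
      rw [← this]; ring]
  exact (hs'.add ht').sub hst'

lemma hasSum_lengthsLE_zero_zero (q : ℂ) :
    HasSum (fun Λ : lengthsLE 0 0 => q ^ Λ.1.size) 1 := by
  have h0 : ∀ Λ ∈ lengthsLE 0 0, ∀ i, Λ.part i = 0 := fun Λ hΛ i => by
    ext j
    rw [mem_lengthsLE] at hΛ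
    fin_cases i
    · exact hΛ.1 j j.zero_le
    · exact hΛ.2 j j.zero_le
  let Z : CylindricPartition ![3, 1] := ⟨fun _ => 0, fun _ => antitone_const, fun _ _ => le_rfl⟩
  have hZ : Z ∈ lengthsLE 0 0 := mem_lengthsLE.mpr ⟨fun _ _ => rfl, fun _ _ => rfl⟩
  convert hasSum_single (⟨Z, hZ⟩ : lengthsLE 0 0) fun Λ hΛ => ?_
  · simp [size, Z]
  · exact absurd (Subtype.ext (CylindricPartition.ext (funext (h0 Λ.1 Λ.2)))) hΛ

lemma hasSum_reduced_succ_succ {q x y z : ℂ} {a b : ℕ}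
    (hx : HasSum (fun Λ : lengthsLE a (b + 1) => q ^ Λ.1.size) x)
    (hy : HasSum (fun Λ : lengthsLE (a + 1) b => q ^ Λ.1.size) y)
    (hz : HasSum (fun Λ : lengthsLE a b => q ^ Λ.1.size) z) :
    HasSum (fun Λ : reduced (c := ![3, 1]) ![a + 1, b + 1] => q ^ Λ.1.size) (x + y - z) := by
  rw [← lengthsLE_inter] at hz
  rw [reduced_succ_succ]
  exact hasSum_union_of_inter (f := fun Λ : CylindricPartition ![3, 1] => q ^ Λ.size) hx hy hz

lemma summable_lengthsLE {q : ℂ} (hq : ‖q‖ < 1) {a b : ℕ} (h₁ : b ≤ a + 1) (h₂ : a ≤ b + 3) :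
    Summable fun Λ : lengthsLE a b => q ^ Λ.1.size := by
  induction hn : a + b using Nat.strong_induction_on generalizing a b with
  | _ n ih =>
    subst hn
    rcases Nat.eq_zero_or_pos (a + b) with h0 | hpos
    · obtain ⟨rfl, rfl⟩ : a = 0 ∧ b = 0 := by omega
      exact (hasSum_lengthsLE_zero_zero q).summable
    suffices Summable fun Λ : reduced (c := ![3, 1]) ![a, b] => q ^ Λ.1.size from
      (hasSum_lengthsLE h₁ h₂ hpos hq this.hasSum).summable
    by_cases hb : b = a + 1
    · subst hb
      rw [reduced_self_succ]
      exact ih _ (by omega) (by omega) (by omega) rfl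
    by_cases ha : a = b + 3
    · subst ha
      rw [reduced_add_three]
      exact ih _ (by omega) (by omega) (by omega) rfl
    obtain ⟨a, rfl⟩ : ∃ a', a = a' + 1 := ⟨a - 1, by omega⟩
    cases b with
    | zero =>
      rw [reduced_succ_zero]
      exact ih _ (by omega) (by omega) (by omega) rfl
    | succ b =>
      have hx := ih (a + (b + 1)) (by omega) (by omega) (by omega) rfl
      have hy := ih (a + 1 + b) (by omega) (by omega) (by omega) rfl
      have hz := ih (a + b) (by omega) (a := a) (b := b) (by omega) (by omega) rfl
      exact (hasSum_reduced_succ_succ hx.hasSum hy.hasSum hz.hasSum).summable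

/-! ### The recurrence in the length bound -/

lemma genFun_zero_zero (q : ℂ) : genFun q 0 0 = 1 := (hasSum_lengthsLE_zero_zero q).tsum_eq

lemma one_sub_mul_genFun {a b : ℕ} (h₁ : b ≤ a + 1) (h₂ : a ≤ b + 3) (hpos : 0 < a + b) {q s : ℂ}
    (hq : ‖q‖ < 1)
    (h : HasSum (fun Λ : reduced (c := ![3, 1]) ![a, b] => q ^ Λ.1.size) s) :
    (1 - q ^ (a + b)) * genFun q a b = s := by
  rw [genFun, (hasSum_lengthsLE h₁ h₂ hpos hq h).tsum_eq,
    mul_inv_cancel_left₀ (one_sub_pow_ne_zero hq hpos.ne')]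

/-! On the edges of the strip `b - 1 ≤ a ≤ b + 3` and of the quadrant only one neighbour
contributes; in the interior, inclusion-exclusion applies. -/

lemma genFun_self_succ {q : ℂ} (hq : ‖q‖ < 1) (a : ℕ) :
    (1 - q ^ (a + (a + 1))) * genFun q a (a + 1) = genFun q a a := by
  refine one_sub_mul_genFun le_rfl (by omega) (by omega) hq ?_
  rw [reduced_self_succ]
  exact (summable_lengthsLE hq (by omega) (by omega)).hasSum

lemma genFun_add_three {q : ℂ} (hq : ‖q‖ < 1) (b : ℕ) :
    (1 - q ^ (b + 3 + b)) * genFun q (b + 3) b = genFun q (b + 2) b := by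
  refine one_sub_mul_genFun (by omega) le_rfl (by omega) hq ?_
  rw [reduced_add_three]
  exact (summable_lengthsLE hq (by omega) (by omega)).hasSum

lemma genFun_succ_zero {q : ℂ} (hq : ‖q‖ < 1) {a : ℕ} (ha : a ≤ 2) :
    (1 - q ^ (a + 1)) * genFun q (a + 1) 0 = genFun q a 0 := by
  refine one_sub_mul_genFun (b := 0) (by omega) (by omega) (by omega) hq ?_
  rw [reduced_succ_zero]
  exact (summable_lengthsLE hq (by omega) (by omega)).hasSum

lemma genFun_succ_succ {q : ℂ} (hq : ‖q‖ < 1) {a b : ℕ} (h₁ : b ≤ a) (h₂ : a ≤ b + 2) :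
    (1 - q ^ (a + 1 + (b + 1))) * genFun q (a + 1) (b + 1)
      = genFun q a (b + 1) + genFun q (a + 1) b - genFun q a b :=
  one_sub_mul_genFun (by omega) (by omega) (by omega) hq <| hasSum_reduced_succ_succ
    (summable_lengthsLE hq (by omega) (by omega)).hasSum
    (summable_lengthsLE hq (by omega) (by omega)).hasSum
    (summable_lengthsLE hq (by omega) (by omega)).hasSum

/-- Eliminating the other four diagonals of the strip leaves a second-order recurrence on the
diagonal `a = b + 1`. -/
lemma genFun_recurrence {q : ℂ} (hq : ‖q‖ < 1) (m : ℕ) :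
    (1 - q ^ (2 * m + 3)) * (1 - q ^ (2 * m + 4)) * (1 - q ^ (2 * m + 5)) *
        genFun q (m + 3) (m + 2)
      = (1 - q ^ (2 * m + 3)) * (1 + q ^ (2 * m + 4) + q ^ (2 * m + 3)) * genFun q (m + 2) (m + 1)
        + q ^ (2 * m + 3) * genFun q (m + 1) m := by
  have hO := genFun_succ_succ hq (a := m + 2) (b := m + 1) (by omega) (by omega)
  have hE := genFun_succ_succ hq (a := m + 1) (b := m + 1) (by omega) (by omega)
  have hH := genFun_succ_succ hq (a := m + 2) (b := m) (by omega) (by omega)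
  have hX := genFun_self_succ hq (m + 1)
  have hY := genFun_add_three hq m
  have hO' := genFun_succ_succ hq (a := m + 1) (b := m) (by omega) (by omega)
  rw [show m + 2 + 1 + (m + 1 + 1) = 2 * m + 5 by ring] at hO
  rw [show m + 1 + 1 + (m + 1 + 1) = 2 * m + 4 by ring] at hE
  rw [show m + 2 + 1 + (m + 1) = 2 * m + 4 by ring] at hH
  rw [show m + 1 + (m + 1 + 1) = 2 * m + 3 by ring] at hX
  rw [show m + 3 + m = 2 * m + 3 by ring] at hY
  rw [show m + 1 + 1 + (m + 1) = 2 * m + 3 by ring] at hO'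
  simp only [add_assoc, Nat.reduceAdd] at hO hE hH hX hY hO'
  -- `hE + hH` involves the outer diagonals only through `hX + hY`, and `hO'` expresses what is left
  -- of the even diagonals `a = b` and `a = b + 2` by the diagonal `a = b + 1`
  linear_combination (1 - q ^ (2 * m + 3)) * (1 - q ^ (2 * m + 4)) * hO
    + (1 - q ^ (2 * m + 3)) * (hE + hH) + hX + hY - q ^ (2 * m + 3) * hO'

/-- The generating function on the diagonal `a = b + 1`, in closed form. -/
lemma genFun_succ_self {q : ℂ} (hq : ‖q‖ < 1) (m : ℕ) :
    qPoch q q (2 * m + 1) * genFun q (m + 1) m = qPoch (q ^ 2) (q ^ 2) m * qConv q m := by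
  have h0 : (1 - q) * genFun q 1 0 = 1 := by
    simpa [genFun_zero_zero] using genFun_succ_zero hq (a := 0) (by omega)
  induction m using Nat.twoStepInduction with
  | zero => simpa [qPoch, qConv_zero] using h0
  | one =>
    have hO := genFun_succ_succ hq (a := 1) (b := 0) (by omega) (by omega)
    have hE := genFun_succ_succ hq (a := 0) (b := 0) (by omega) (by omega)
    have hH := genFun_succ_zero hq (a := 1) (by omega)
    have hX := genFun_self_succ hq 0
    have hr := qConv_one hq
    simp only [genFun_zero_zero, zero_add, Nat.reduceAdd, pow_one] at hO hE hH hX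
    simp only [qPoch, Finset.prod_range_succ, Finset.prod_range_zero]
    linear_combination (1 - q) * (1 - q ^ 2) * hO + (1 - q) * (hE + hH) + hX
      + (1 + q ^ 2) * h0 - hr
  | more m ih₀ ih₁ =>
    have hrec := genFun_recurrence hq m
    have hr := qConv_recurrence hq m
    have hP : qPoch q q (2 * (m + 1) + 1)
        = qPoch q q (2 * m + 1) * (1 - q ^ (2 * m + 2)) * (1 - q ^ (2 * m + 3)) := by
      rw [show 2 * (m + 1) + 1 = 2 * m + 1 + 1 + 1 by ring, qPoch_succ, qPoch_succ]
      ring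
    have hP' : qPoch q q (2 * (m + 2) + 1)
        = qPoch q q (2 * (m + 1) + 1) * (1 - q ^ (2 * m + 4)) * (1 - q ^ (2 * m + 5)) := by
      rw [show 2 * (m + 2) + 1 = 2 * (m + 1) + 1 + 1 + 1 by ring, qPoch_succ, qPoch_succ]
      ring
    have hR : qPoch (q ^ 2) (q ^ 2) (m + 1)
        = qPoch (q ^ 2) (q ^ 2) m * (1 - q ^ (2 * m + 2)) := by
      rw [qPoch_succ]
      ring
    have hR' : qPoch (q ^ 2) (q ^ 2) (m + 2)
        = qPoch (q ^ 2) (q ^ 2) (m + 1) * (1 - q ^ (2 * m + 4)) := by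
      rw [qPoch_succ]
      ring
    rw [hP, hR] at ih₁
    rw [hP', hP, hR', hR]
    simp only [add_assoc, Nat.reduceAdd] at *
    linear_combination qPoch q q (2 * m + 1) * (1 - q ^ (2 * m + 2)) * hrec
      + (1 + q ^ (2 * m + 4) + q ^ (2 * m + 3)) * ih₁
      + q ^ (2 * m + 3) * (1 - q ^ (2 * m + 2)) * ih₀
      - qPoch (q ^ 2) (q ^ 2) m * (1 - q ^ (2 * m + 2)) * hr

/-! ### Removing the length bound -/

/-- The length bound `lengthsLE (m + 1) m` exhausts all cylindric partitions as `m → ∞`, so this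
limit is the value of the full generating function. -/
lemma tendsto_genFun {q : ℂ} (hq : ‖q‖ < 1) :
    Tendsto (fun m => genFun q (m + 1) m) atTop
      (𝓝 ((∑' n : ℕ, q ^ (n ^ 2) / qPoch (q ^ 2) (q ^ 2) n) *
        (qPochInf (-q ^ 2) (q ^ 2) / qPochInf q q))) := by
  have hQ := norm_pow_lt_one hq two_ne_zero
  have hodd : Tendsto (fun m : ℕ => 2 * m + 1) atTop atTop :=
    tendsto_atTop_mono (fun m => show m ≤ 2 * m + 1 by omega) tendsto_id
  have h := ((tendsto_qPoch (q ^ 2) hQ).mul (tendsto_qConv hq)).div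
    ((tendsto_qPoch q hq).comp hodd) (qPochInf_self_ne_zero hq)
  have hne := qPochInf_self_ne_zero hQ
  have hne' := qPochInf_self_ne_zero hq
  convert h.congr fun m => ?_ using 2
  · field_simp
  · simp only [Pi.div_apply, Function.comp_apply, ← genFun_succ_self hq m]
    exact mul_div_cancel_left₀ _ (qPoch_self_ne_zero hq _)

lemma monotone_lengthsLE : Monotone fun m => lengthsLE (m + 1) m := fun m n hmn Λ h =>
  mem_lengthsLE'.mpr ⟨part_eq_zero_of_le (by omega) (mem_lengthsLE'.mp h).1,
    part_eq_zero_of_le hmn (mem_lengthsLE'.mp h).2⟩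

lemma exists_mem_lengthsLE (Λ : CylindricPartition ![3, 1]) : ∃ m, Λ ∈ lengthsLE (m + 1) m := by
  have h : ∀ f : ℕ →₀ ℕ, ∀ᶠ j in atTop, f j = 0 := fun f => by
    rw [← Nat.cofinite_eq_atTop]
    exact f.hasFiniteSupport.eventually_cofinite_notMem.mono fun j hj => by simpa using hj
  obtain ⟨m, h0, h1⟩ := ((h (Λ.part 0)).and (h (Λ.part 1))).exists
  exact ⟨m, mem_lengthsLE'.mpr ⟨part_eq_zero_of_le m.le_succ h0, h1⟩⟩

/-- Absolute convergence: the sums of `‖q‖ ^ |Λ|` over the exhausting sets `lengthsLE (m + 1) m`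
converge, hence are bounded. -/
lemma summable_norm_pow_size {q : ℂ} (hq : ‖q‖ < 1) :
    Summable fun Λ : CylindricPartition ![3, 1] => ‖q‖ ^ Λ.size := by
  have hq' : ‖((‖q‖ : ℝ) : ℂ)‖ < 1 := by simpa using hq
  obtain ⟨C, hC⟩ := isBounded_iff_forall_norm_le.mp
    (Metric.isBounded_range_of_tendsto _ (tendsto_genFun hq'))
  refine summable_of_sum_le (c := C) (fun Λ => by positivity) fun u => ?_
  obtain ⟨m, hm⟩ : ∃ m, ∀ Λ ∈ u, Λ ∈ lengthsLE (m + 1) m := by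
    choose g hg using exists_mem_lengthsLE
    exact ⟨u.sup g, fun Λ hΛ => monotone_lengthsLE (Finset.le_sup hΛ) (hg Λ)⟩
  have hsum : Summable fun Λ : lengthsLE (m + 1) m => ‖q‖ ^ Λ.1.size := by
    have := summable_lengthsLE hq' (a := m + 1) (b := m) (by omega) (by omega)
    exact_mod_cast this
  classical
  calc ∑ Λ ∈ u, ‖q‖ ^ Λ.size
      = ∑ Λ ∈ u.subtype (· ∈ lengthsLE (m + 1) m), ‖q‖ ^ Λ.1.size := by
        rw [Finset.sum_subtype_of_mem (fun Λ : CylindricPartition ![3, 1] => ‖q‖ ^ Λ.size) hm]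
    _ ≤ ∑' Λ : lengthsLE (m + 1) m, ‖q‖ ^ Λ.1.size :=
        hsum.sum_le_tsum _ fun _ _ => by positivity
    _ ≤ ‖genFun (‖q‖ : ℝ) (m + 1) m‖ := by
        have : genFun (‖q‖ : ℝ) (m + 1) m
            = ((∑' Λ : lengthsLE (m + 1) m, ‖q‖ ^ Λ.1.size : ℝ) : ℂ) := by
          rw [genFun, Complex.ofReal_tsum]
          simp only [Complex.ofReal_pow]
        rw [this, Complex.norm_real]
        exact le_abs_self _
    _ ≤ C := hC _ ⟨m, rfl⟩

lemma hasSum_pow_size {q : ℂ} (hq : ‖q‖ < 1) :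
    HasSum (fun Λ : CylindricPartition ![3, 1] => q ^ Λ.size)
      ((∑' n : ℕ, q ^ (n ^ 2) / qPoch (q ^ 2) (q ^ 2) n) *
        (qPochInf (-q ^ 2) (q ^ 2) / qPochInf q q)) := by
  have hs := summable_norm_pow_size hq
  have hsum : Summable fun Λ : CylindricPartition ![3, 1] => q ^ Λ.size :=
    Summable.of_norm (by simpa only [norm_pow] using hs)
  have hlim : Tendsto (fun m => genFun q (m + 1) m) atTop
      (𝓝 (∑' Λ : CylindricPartition ![3, 1], q ^ Λ.size)) := by
    have h : ∀ m, genFun q (m + 1) m = ∑' Λ, (lengthsLE (m + 1) m).indicator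
        (fun Λ : CylindricPartition ![3, 1] => q ^ Λ.size) Λ := fun m =>
      tsum_subtype (lengthsLE (m + 1) m) fun Λ : CylindricPartition ![3, 1] => q ^ Λ.size
    simp_rw [h]
    refine tendsto_tsum_of_dominated_convergence hs (fun Λ => ?_)
      (Eventually.of_forall fun m Λ => ?_)
    -- each indicator is eventually equal to `1`
    · obtain ⟨m, hm⟩ := exists_mem_lengthsLE Λ
      refine tendsto_const_nhds.congr' ?_
      filter_upwards [eventually_ge_atTop m] with n hn
      rw [Set.indicator_of_mem (monotone_lengthsLE hn hm)]
    · rw [← norm_pow]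
      exact norm_indicator_le_norm_self (s := lengthsLE (m + 1) m)
        (f := fun Λ : CylindricPartition ![3, 1] => q ^ Λ.size) Λ
  rw [← tendsto_nhds_unique hlim (tendsto_genFun hq)]
  exact hsum.hasSum

end CylindricPartition

theorem mainTheorem2 (q : ℂ) (hq : ‖q‖ < 1) :
    Tendsto (qPoch (-q ^ 2) (q ^ 2)) atTop (𝓝 (qPochInf (-q ^ 2) (q ^ 2))) ∧
    Tendsto (qPoch q q) atTop (𝓝 (qPochInf q q)) ∧ qPochInf q q ≠ 0 ∧
    (∀ n : ℕ, qPoch (q ^ 2) (q ^ 2) n ≠ 0) ∧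
    Summable (fun n : ℕ => q ^ (n ^ 2) / qPoch (q ^ 2) (q ^ 2) n) ∧
    HasSum (fun Λ : CylindricPartition ![3, 1] => q ^ Λ.size)
      ((∑' n : ℕ, q ^ (n ^ 2) / qPoch (q ^ 2) (q ^ 2) n) *
        (qPochInf (-q ^ 2) (q ^ 2) / qPochInf q q)) := by
  have hQ : ‖q ^ 2‖ < 1 := norm_pow_lt_one hq two_ne_zero
  exact ⟨tendsto_qPoch _ hQ, tendsto_qPoch _ hq, qPochInf_self_ne_zero hq, qPoch_self_ne_zero hQ,
    summable_pow_sq_div_qPoch hq, CylindricPartition.hasSum_pow_size hq⟩
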